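/- Let $(\mathcal S,\mathcal A,P,r)$ be a Markov decision process with finite nonempty state space $\mathcal S$ and action space $\mathcal A$, transition kernel $P(\cdot\mid s,a)$ and rewards $r(s,a)\in[0,1]$. Policies are stationary randomized maps $\pi:\mathcal S\to\Delta(\mathcal A)$; $\mathbb E^\pi_s$ is the expectation over trajectories $(S_0,A_0,S_1,A_1,\dots)$ with $S_0=s$, $A_t\sim\pi(S_t)$, $S_{t+1}\sim P(\cdot\mid S_t,A_t)$. Write $P_{sa}v=\sum_{s'}P(s'\mid s,a)v(s')$, $\operatorname{sp}(v)=\max_s v(s)-\min_s v(s)$, and $\mathcal T(V)(s)=\max_a\,(r(s,a)+P_{sa}V)$, with $t$-fold iterate $\mathcal T^{(t)}$. Let $$V^\pi_\gamma(s)=\mathbb E^\pi_s\Big[\sum_{t\ge0}\gamma^t r(S_t,A_t)\Big],\quad V^\star_\gamma=\sup_\pi V^\pi_\gamma,\quad \rho^\pi(s)=\lim_{T\to\infty}\tfrac1T\,\mathbb E^\pi_s\Big[\sum_{t<T}r(S_t,A_t)\Big],\quad \rho^\star=\sup_\pi\rho^\pi$$ (elementwise suprema over all such policies), and let the bias $h^\pi(s)$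 be the Cesàro limit, as $T\to\infty$, of $\mathbb E^\pi_s[\sum_{t<T}(r(S_t,A_t)-\rho^\pi(S_t))]$. Let $\pi^\star$ be any Blackwell-optimal policy, i.e. there is $\bar\gamma<1$ with $V^{\pi^\star}_\gamma=V^\star_\gamma$ for all $\gamma\in[0,1)$ with $\gamma\ge\bar\gamma$. Let $$\mathsf T_{\mathrm{drop}}=\max_{\pi\ \mathrm{deterministic}}\ \max_{s}\ \mathbb E^\pi_s\Big[\sum_{t\ge0}\mathbb I\big(P_{S_tA_t}\rho^\star<\rho^\star(S_t)\big)\Big],$$ which is finite. Let $h\in\mathbb R^{\mathcal S}$ be such that, for some $\rho\in\mathbb R^{\mathcal S}$, the pair $(\rho,h)$ satisfies both the modified and the unmodified multichain Bellman equations, i.e. for all $s$ $$\max_a P_{sa}\rho=\rho(s),\qquad \max_a\,\big(r(s,a)+P_{sa}h\big)=\rho(s)+h(s)=\max_{a:\,P_{sa}\rho=\rho(s)}\big(r(s,a)+P_{sa}h\big).$$ Then for every $\gamma\in(0,1)$ and every integer $t$ with $0<t\le\frac1{1-\gamma}$, $$\Big\|\frac{1}{t(1-\gamma)}\mathcal T^{(t)}(\mathbf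 0)-V^\star_\gamma\Big\|_\infty\le 2\,\frac{\min\big\{\operatorname{sp}(h),\ \operatorname{sp}(h^{\pi^\star})+\mathsf T_{\mathrm{drop}}+\operatorname{sp}(h^{\pi^\star})\,\mathsf T_{\mathrm{drop}}\big\}}{t}\cdot\frac1{1-\gamma}.$$ -/

import Mathlib

open MeasureTheory ProbabilityTheory Filter Topology
open scoped ENNReal

/-- A Markov decision process with state space `S`, action space `A`, transition kernel `P`
and reward function `r` with values in `[0, 1]`. -/
structure MDP (S A : Type*) where
  /-- the distribution `P(· | s, a)` of the next state -/
  P : S → A → PMF S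
  /-- the reward of the action `a` in the state `s` -/
  r : S → A → ℝ
  r_nonneg : ∀ s a, 0 ≤ r s a
  r_le_one : ∀ s a, r s a ≤ 1

/-- A (stationary, randomized) Markovian policy: for each state a distribution over actions. -/
abbrev RandPolicy (S A : Type*) := S → PMF A

/-- A deterministic policy `S → A`, viewed as a policy that puts all its mass on one action. -/
noncomputable def RandPolicy.ofDet {S A : Type*} (d : S → A) : RandPolicy S A :=
  fun s => PMF.pure (d s)

/-- The span seminorm `max v - min v` (for a finite nonempty index type). -/
noncomputable def spanSeminorm {S : Type*} (v : S → ℝ) : ℝ :=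
  (⨆ s, v s) - (⨅ s, v s)

/-- The Cesàro limit of a real sequence. -/
noncomputable def cesaroLim (x : ℕ → ℝ) : ℝ :=
  limUnder atTop (fun N : ℕ => (1 / (N : ℝ)) * ∑ T ∈ Finset.range N, x T)

namespace MDP

variable {S A : Type*}

/-- `P_{sa} v = ∑ s', P(s' | s, a) v(s')`. -/
noncomputable def expNext [Fintype S] (M : MDP S A) (s : S) (a : A) (v : S → ℝ) : ℝ :=
  ∑ s', (M.P s a s').toReal * v s'

/-- The Bellman optimality operator `V ↦ max_a (r(s, a) + γ P_{sa} V)` with discount factor `γ`;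
the undiscounted (average-reward) operator is the case `γ = 1`. -/
noncomputable def bellman [Fintype S] (M : MDP S A) (γ : ℝ) (V : S → ℝ) : S → ℝ :=
  fun s => ⨆ a, (M.r s a + γ * M.expNext s a V)

/-- The multichain optimality equations:
`max_a P_{sa} ρ = ρ(s)` and
`max_{a : P_{sa} ρ = ρ(s)} (r(s, a) + P_{sa} h) = ρ(s) + h(s)` for all `s`. -/
def UnmodifiedBellman [Fintype S] (M : MDP S A) (ρ h : S → ℝ) : Prop :=
  (∀ s, IsGreatest {x | ∃ a, x = M.expNext s a ρ} (ρ s)) ∧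
  (∀ s, IsGreatest {x | ∃ a, M.expNext s a ρ = ρ s ∧ x = M.r s a + M.expNext s a h} (ρ s + h s))

/-- The modified multichain optimality equations:
`max_a P_{sa} ρ = ρ(s)` and `max_a (r(s, a) + P_{sa} h) = ρ(s) + h(s)` for all `s`. -/
def ModifiedBellman [Fintype S] (M : MDP S A) (ρ h : S → ℝ) : Prop :=
  (∀ s, IsGreatest {x | ∃ a, x = M.expNext s a ρ} (ρ s)) ∧
  (∀ s, IsGreatest {x | ∃ a, x = M.r s a + M.expNext s a h} (ρ s + h s))

/-- The law of `(S', A')` given the current pair `(s, a)`: `S' ∼ P(· | s, a)`, `A' ∼ π(S')`. -/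
noncomputable def stepPMF (M : MDP S A) (π : RandPolicy S A) (x : S × A) : PMF (S × A) :=
  (M.P x.1 x.2).bind fun s' => (π s').map fun a' => (s', a')

/-- The law of `(S_0, A_0)` for the initial state `s`: `S_0 = s`, `A_0 ∼ π(s)`. -/
noncomputable def initPMF (π : RandPolicy S A) (s : S) : PMF (S × A) :=
  (π s).map fun a => (s, a)

section Trajectories

variable [Fintype S] [Fintype A] [MeasurableSpace S] [MeasurableSpace A]
  [DiscreteMeasurableSpace S] [DiscreteMeasurableSpace A]

/-- The Markov kernel on state-action pairs that a policy induces. -/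
noncomputable def stepKernel (M : MDP S A) (π : RandPolicy S A) : Kernel (S × A) (S × A) :=
  ⟨fun x => (M.stepPMF π x).toMeasure, measurable_of_countable _⟩

instance (M : MDP S A) (π : RandPolicy S A) : IsMarkovKernel (M.stepKernel π) :=
  ⟨fun x => PMF.toMeasure.isProbabilityMeasure (M.stepPMF π x)⟩

/-- The law of the next pair `(S_{n+1}, A_{n+1})` given the history `(S_0, A_0, …, S_n, A_n)`;
it depends on the last pair only. -/
noncomputable def historyKernel (M : MDP S A) (π : RandPolicy S A) (n : ℕ) :
    Kernel (∀ _ : Finset.Iic n, S × A) (S × A) :=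
  (M.stepKernel π).comap (fun x => x ⟨n, Finset.mem_Iic.2 le_rfl⟩) (measurable_pi_apply _)

instance (M : MDP S A) (π : RandPolicy S A) (n : ℕ) : IsMarkovKernel (M.historyKernel π n) := by
  unfold historyKernel; infer_instance

/-- The law of the trajectory `(S_0, A_0, S_1, A_1, …)` with `S_0 = s`, `A_t ∼ π(S_t)` and
`S_{t+1} ∼ P(· | S_t, A_t)`. -/
noncomputable def trajLaw (M : MDP S A) (π : RandPolicy S A) (s : S) : Measure (ℕ → S × A) :=
  Kernel.trajMeasure (X := fun _ => S × A) (initPMF π s).toMeasure (M.historyKernel π)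

/-- The discounted value function `V_γ^π(s) = E_s^π [∑_t γ^t R_t]`, `R_t = r(S_t, A_t)`. -/
noncomputable def value (M : MDP S A) (γ : ℝ) (π : RandPolicy S A) (s : S) : ℝ :=
  ∫ ω, (∑' t : ℕ, γ ^ t * M.r (ω t).1 (ω t).2) ∂(M.trajLaw π s)

/-- The optimal discounted value function: the elementwise supremum over all policies. -/
noncomputable def optValue (M : MDP S A) (γ : ℝ) (s : S) : ℝ :=
  ⨆ π : RandPolicy S A, M.value γ π s

/-- The gain `ρ^π(s) = lim_T (1/T) E_s^π [∑_{t < T} R_t]`. -/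
noncomputable def gain (M : MDP S A) (π : RandPolicy S A) (s : S) : ℝ :=
  limUnder atTop (fun T : ℕ =>
    (1 / (T : ℝ)) * ∫ ω, (∑ t ∈ Finset.range T, M.r (ω t).1 (ω t).2) ∂(M.trajLaw π s))

/-- The optimal gain: the elementwise supremum over all policies. -/
noncomputable def optGain (M : MDP S A) (s : S) : ℝ :=
  ⨆ π : RandPolicy S A, M.gain π s

/-- The bias `h^π(s)`: the Cesàro limit of `E_s^π [∑_{t < T} (R_t - ρ^π(S_t))]` as `T → ∞`. -/
noncomputable def bias (M : MDP S A) (π : RandPolicy S A) (s : S) : ℝ :=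
  cesaroLim (fun T : ℕ =>
    ∫ ω, (∑ t ∈ Finset.range T, (M.r (ω t).1 (ω t).2 - M.gain π (ω t).1)) ∂(M.trajLaw π s))

/-- `π` is Blackwell-optimal: it is discounted-optimal for all discount factors close to `1`. -/
def IsBlackwellOptimal (M : MDP S A) (π : RandPolicy S A) : Prop :=
  ∃ γ₀ < (1 : ℝ), ∀ γ : ℝ, 0 ≤ γ → γ₀ ≤ γ → γ < 1 → M.value γ π = M.optValue γ

/-- The gain-dropping time of a policy: the maximum over the initial state `s` of
`E_s^π [∑_t 𝟙(P_{S_t, A_t} ρ* < ρ*(S_t))]`, a priori in `[0, ∞]`. -/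
noncomputable def policyDropTime (M : MDP S A) (π : RandPolicy S A) : ℝ≥0∞ :=
  ⨆ s, ∫⁻ ω, (∑' t : ℕ,
    {x : S × A | M.expNext x.1 x.2 M.optGain < M.optGain x.1}.indicator
      (fun _ => (1 : ℝ≥0∞)) (ω t)) ∂(M.trajLaw π s)

/-- The gain-dropping time of the MDP: the maximum over all deterministic policies. -/
noncomputable def dropTime (M : MDP S A) : ℝ≥0∞ :=
  ⨆ d : S → A, M.policyDropTime (RandPolicy.ofDet d)

end Trajectories

end MDP

/-! Both quantities are compared with the same gain vector `ρ`: the iterate is `t ρ` up to an error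
`K`, the optimal value is `ρ / (1 - γ)` up to an error `K`. Dividing by `t (1 - γ) ≤ 1` gives twice
`K / (t (1 - γ))`. Upper bounds need a potential `g'` with `P ρ ≤ ρ` and `r + P g' ≤ ρ + g'` for
every action; lower bounds need one policy that preserves `ρ` and solves the Poisson equation with a
potential `g`. This is `norm_iterate_bellman_sub_optValue_le`, where `K` bounds both spans.

For `sp(h)`, take `g = g' = h`: the modified equation gives the upper bound, an action attaining the
unmodified one the policy.

For the other bound, `g` is the bias `b` of the Blackwell-optimal policy and `ρ` is the optimal
gain. Then `r + P b ≤ ρ + b` is known only for actions preserving the gain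
(`IsBlackwellOptimal.spec`, by comparing orders in the Laurent expansion of the discounted values).
An action that drops the gain violates it by at most `1 + sp(b)`. This is repaired by `g' = b + (1 +
sp(b)) U`, where `0 ≤ U ≤ T_drop` and `U` falls by at least one in expectation at each such action
(`exists_dropTime_potential`). -/

section MarkovOperator

/-! ### Monotone linear operators fixing constants, and their ergodic theory -/

variable {S : Type*} {Q : (S → ℝ) →ₗ[ℝ] (S → ℝ)}

theorem MarkovOperator.map_const (hone : Q 1 = 1) (c : ℝ) : Q (fun _ => c) = fun _ => c := by
  have : (fun _ : S => c) = c • (1 : S → ℝ) := by ext; simp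
  rw [this, map_smul, hone]

theorem MarkovOperator.pow_nonneg (hmono : Monotone Q) {v : S → ℝ} (hv : 0 ≤ v) (n : ℕ) :
    0 ≤ (Q ^ n) v := by
  induction n with
  | zero => simpa using hv
  | succ n ih =>
    rw [pow_succ', Module.End.mul_apply]
    simpa using hmono ih

/-- Coboundaries telescope, hence have bounded partial sums; the gain, the bias and the finiteness
of the drop count all rest on this. -/
theorem MarkovOperator.sum_pow_sub (g : S → ℝ) (n : ℕ) :
    ∑ k ∈ Finset.range n, (Q ^ k) (g - Q g) = g - (Q ^ n) g := by
  have h := Finset.sum_range_sub' (fun k => (Q ^ k) g) n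
  simp only [pow_zero, Module.End.one_apply] at h
  rw [← h]
  refine Finset.sum_congr rfl fun k _ => ?_
  rw [map_sub, pow_succ, Module.End.mul_apply]

theorem MarkovOperator.pow_apply_of_fixed {ρ : S → ℝ} (hρ : Q ρ = ρ) (n : ℕ) :
    (Q ^ n) ρ = ρ := by
  induction n with
  | zero => simp
  | succ n ih => rw [pow_succ, Module.End.mul_apply, hρ, ih]

variable [Fintype S]

theorem MarkovOperator.norm_apply_le (hmono : Monotone Q) (hone : Q 1 = 1) (v : S → ℝ) :
    ‖Q v‖ ≤ ‖v‖ := by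
  refine (pi_norm_le_iff_of_nonneg (norm_nonneg v)).2 fun s => ?_
  rw [Real.norm_eq_abs, abs_le]
  have h1 : v ≤ fun _ => ‖v‖ := fun i => (le_abs_self _).trans (norm_le_pi_norm v i)
  have h2 : (fun _ => -‖v‖) ≤ v := fun i =>
    neg_le_of_abs_le (norm_le_pi_norm v i)
  have h3 := hmono h1 s
  have h4 := hmono h2 s
  rw [MarkovOperator.map_const hone] at h3 h4
  exact ⟨h4, h3⟩

theorem MarkovOperator.norm_pow_apply_le (hmono : Monotone Q) (hone : Q 1 = 1) (v : S → ℝ)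
    (n : ℕ) : ‖(Q ^ n) v‖ ≤ ‖v‖ := by
  induction n with
  | zero => simp
  | succ n ih =>
    rw [pow_succ', Module.End.mul_apply]
    exact (MarkovOperator.norm_apply_le hmono hone _).trans ih

/-- The comparison principle for the discounted evaluation equation. -/

theorem MarkovOperator.nonneg_of_discount_le (hmono : Monotone Q) (hone : Q 1 = 1) {γ : ℝ}
    (hγ0 : 0 ≤ γ) (hγ1 : γ < 1) {X : S → ℝ} (hX : γ • Q X ≤ X) : 0 ≤ X := by
  intro s
  obtain ⟨s₀, hs₀⟩ : ∃ s₀, ∀ s, X s₀ ≤ X s :=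
    haveI : Nonempty S := ⟨s⟩
    Finite.exists_min X
  have h1 : (fun _ => X s₀) ≤ X := hs₀
  have h2 := hmono h1 s₀
  rw [MarkovOperator.map_const hone] at h2
  have h3 : γ * Q X s₀ ≤ X s₀ := hX s₀
  have h4 : γ * X s₀ ≤ γ * Q X s₀ := mul_le_mul_of_nonneg_left h2 hγ0
  have : 0 ≤ X s₀ := by nlinarith
  exact this.trans (hs₀ s)

/-- The mean ergodic decomposition: every vector is the sum of a fixed vector and a coboundary,
whose potential is itself a coboundary. -/

theorem MarkovOperator.exists_ergodic_decomposition (hmono : Monotone Q) (hone : Q 1 = 1)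
    (f : S → ℝ) : ∃ ρ w : S → ℝ, Q ρ = ρ ∧ f = ρ + (w - Q w) - Q (w - Q w) := by
  set D : (S → ℝ) →ₗ[ℝ] (S → ℝ) := LinearMap.id - Q with hD
  have hDa : ∀ v, D v = v - Q v := fun v => rfl
  have hdisj : Disjoint (LinearMap.ker D) (LinearMap.range D) := by
    rw [Submodule.disjoint_def]
    rintro x hx ⟨w, rfl⟩
    have hfix : Q (D w) = D w := by
      have := LinearMap.mem_ker.1 hx
      rw [hDa (D w), sub_eq_zero] at this
      exact this.symm
    -- A fixed coboundary has partial sums `n • D w`, yet they telescope to a bounded vector, so it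
    -- vanishes.
    have hb : ∀ n : ℕ, (n : ℝ) * ‖D w‖ ≤ 2 * ‖w‖ := fun n => by
      have h1 := MarkovOperator.sum_pow_sub (Q := Q) w n
      rw [← hDa, Finset.sum_congr rfl fun k _ => MarkovOperator.pow_apply_of_fixed hfix k,
        Finset.sum_const, Finset.card_range] at h1
      have h2 := norm_sub_le w ((Q ^ n) w)
      rw [← h1, ← Nat.cast_smul_eq_nsmul ℝ, norm_smul, Real.norm_natCast] at h2
      linarith [MarkovOperator.norm_pow_apply_le hmono hone w n]
    rw [← norm_eq_zero]
    by_contra hne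
    have hpos : 0 < ‖D w‖ := lt_of_le_of_ne (norm_nonneg _) (Ne.symm hne)
    obtain ⟨n, hn⟩ := exists_nat_gt (2 * ‖w‖ / ‖D w‖)
    rw [div_lt_iff₀ hpos] at hn
    linarith [hb n]
  have hsup : LinearMap.ker D ⊔ LinearMap.range D = ⊤ := by
    apply Submodule.eq_top_of_disjoint _ _ _ hdisj
    rw [add_comm, LinearMap.finrank_range_add_finrank_ker]
  have hdec : ∀ v : S → ℝ, ∃ ρ w, Q ρ = ρ ∧ v = ρ + D w := fun v => by
    have hv : v ∈ LinearMap.ker D ⊔ LinearMap.range D := hsup ▸ Submodule.mem_top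
    obtain ⟨ρ, hρ, _, ⟨w, rfl⟩, rfl⟩ := Submodule.mem_sup.1 hv
    refine ⟨ρ, w, ?_, rfl⟩
    have := LinearMap.mem_ker.1 hρ
    rw [hDa, sub_eq_zero] at this
    exact this.symm
  -- The potential is decomposed again; its fixed part `κ` is annihilated by `D` and can be
  -- discarded.
  obtain ⟨ρ, g, hρ, hf⟩ := hdec f
  obtain ⟨κ, w, hκ, hg⟩ := hdec g
  refine ⟨ρ, w, hρ, ?_⟩
  rw [hf, hDa, hg, map_add, hκ, hDa]
  abel

/-- The truncated Laurent expansion of the solution of the discounted evaluation equation. -/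

theorem MarkovOperator.abs_sub_laurent_le (hmono : Monotone Q) (hone : Q 1 = 1) {γ : ℝ}
    (hγ0 : 0 ≤ γ) (hγ1 : γ < 1) {f ρ w V : S → ℝ} (hρ : Q ρ = ρ)
    (hf : f = ρ + (w - Q w) - Q (w - Q w)) (hV : V = f + γ • Q V) (s : S) :
    |V s - ρ s / (1 - γ) - (w - Q w) s| ≤ 2 * (1 - γ) * ‖w‖ := by
  have hγ : 0 < 1 - γ := by linarith
  set c := (1 - γ)⁻¹ with hc
  have hcγ : c * (1 - γ) = 1 := inv_mul_cancel₀ hγ.ne'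
  -- The correction `(1 - γ) • Q w` cancels the first-order residual. What remains has order `(1 -
  -- γ) ^ 2`, so comparison with a constant bounds `F` by `(1 - γ) * ‖w‖`; the correction itself
  -- costs the same again, whence the factor 2.
  set F : S → ℝ := V - c • ρ - (w - Q w) + (1 - γ) • Q w with hF
  have key : F - γ • Q F = (1 - γ) ^ 2 • Q (Q w) := by
    ext i
    have hVi := congrFun hV i
    have hfi := congrFun hf i
    simp only [hF, map_add, map_sub, map_smul, hρ, Pi.add_apply, Pi.sub_apply, Pi.smul_apply,
      smul_eq_mul] at hVi hfi ⊢
    linear_combination hVi + hfi - ρ i * hcγ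
  have hww : ‖Q (Q w)‖ ≤ ‖w‖ := by
    simpa [pow_two] using MarkovOperator.norm_pow_apply_le hmono hone w 2
  have hQww : ∀ i, |Q (Q w) i| ≤ ‖w‖ := fun i => (norm_le_pi_norm _ i).trans hww
  have hQw : ∀ i, |Q w i| ≤ ‖w‖ := fun i =>
    (norm_le_pi_norm _ i).trans (MarkovOperator.norm_apply_le hmono hone w)
  have hconst := MarkovOperator.map_const hone ((1 - γ) * ‖w‖)
  have up : 0 ≤ (fun _ : S => (1 - γ) * ‖w‖) - F := by
    refine MarkovOperator.nonneg_of_discount_le hmono hone hγ0 hγ1 fun i => ?_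
    have hk := congrFun key i
    have := (abs_le.1 (hQww i)).2
    rw [map_sub, hconst]
    simp only [Pi.sub_apply, Pi.smul_apply, smul_eq_mul] at hk ⊢
    nlinarith [mul_le_mul_of_nonneg_left this (sq_nonneg (1 - γ))]
  have lo : 0 ≤ F + (fun _ : S => (1 - γ) * ‖w‖) := by
    refine MarkovOperator.nonneg_of_discount_le hmono hone hγ0 hγ1 fun i => ?_
    have hk := congrFun key i
    have := (abs_le.1 (hQww i)).1
    rw [map_add, hconst]
    simp only [Pi.sub_apply, Pi.add_apply, Pi.smul_apply, smul_eq_mul] at hk ⊢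
    nlinarith [mul_le_mul_of_nonneg_left this (sq_nonneg (1 - γ))]
  have hu := up s
  have hl := lo s
  have hq := abs_le.1 (hQw s)
  have hq1 := mul_le_mul_of_nonneg_left hq.1 hγ.le
  have hq2 := mul_le_mul_of_nonneg_left hq.2 hγ.le
  have hdiv : ρ s / (1 - γ) = c * ρ s := by rw [hc]; ring
  simp only [hF, Pi.zero_apply, Pi.sub_apply, Pi.add_apply, Pi.smul_apply, smul_eq_mul] at hu hl
  rw [abs_le, hdiv]
  simp only [Pi.sub_apply]
  constructor <;> linarith

/-- A (discounted or total) series of iterates solves the evaluation equation. -/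

theorem MarkovOperator.tsum_eq_add (γ : ℝ) (f : S → ℝ)
    (hs : ∀ s, Summable fun k : ℕ => γ ^ k * (Q ^ k) f s) :
    (fun s => ∑' k : ℕ, γ ^ k * (Q ^ k) f s)
      = f + γ • Q (fun s => ∑' k : ℕ, γ ^ k * (Q ^ k) f s) := by
  have hsum : HasSum (fun k : ℕ => γ ^ k • (Q ^ k) f) (fun s => ∑' k : ℕ, γ ^ k * (Q ^ k) f s) :=
    Pi.hasSum.2 fun s => (hs s).hasSum
  have hcont : Continuous Q := LinearMap.continuous_of_finiteDimensional Q
  have h1 := (hsum.map Q.toAddMonoidHom hcont).const_smul γ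
  have h2 := (hasSum_nat_add_iff' 1).2 hsum
  have h3 : (fun n : ℕ => γ ^ (n + 1) • (Q ^ (n + 1)) f)
      = fun n => γ • ((⇑Q.toAddMonoidHom) ∘ fun k : ℕ => γ ^ k • (Q ^ k) f) n := by
    ext1 n
    simp only [Function.comp_apply, LinearMap.toAddMonoidHom_coe, map_smul, smul_smul]
    rw [pow_succ' Q, Module.End.mul_apply, pow_succ']
  rw [h3] at h2
  have h4 := h2.unique h1
  simp only [Finset.range_one, Finset.sum_singleton, pow_zero, one_smul, Module.End.one_apply,
    LinearMap.toAddMonoidHom_coe] at h4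
  rw [← h4]
  abel

theorem MarkovOperator.summable_discounted (hmono : Monotone Q) (hone : Q 1 = 1) {γ : ℝ}
    (hγ0 : 0 ≤ γ) (hγ1 : γ < 1) (f : S → ℝ) (s : S) :
    Summable fun k : ℕ => γ ^ k * (Q ^ k) f s := by
  refine Summable.of_norm_bounded
    ((summable_geometric_of_lt_one hγ0 hγ1).mul_right ‖f‖) fun k => ?_
  rw [norm_mul, Real.norm_of_nonneg (_root_.pow_nonneg hγ0 k)]
  exact mul_le_mul_of_nonneg_left ((norm_le_pi_norm _ s).trans
    (MarkovOperator.norm_pow_apply_le hmono hone f k)) (_root_.pow_nonneg hγ0 k)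

end MarkovOperator

/-! ### Policy averages, transition operators and expectations along trajectories -/

theorem PMF.sum_toReal_eq_one {α : Type*} [Fintype α] (p : PMF α) :
    ∑ a, (p a).toReal = 1 := by
  rw [← ENNReal.toReal_sum fun a _ => p.apply_ne_top a]
  have := p.tsum_coe
  rw [tsum_fintype] at this
  simp [this]

namespace MDP

theorem toReal_stepPMF_apply {S A : Type*} (M : MDP S A) (π : RandPolicy S A) (x y : S × A) :
    (M.stepPMF π x y).toReal = (M.P x.1 x.2 y.1).toReal * (π y.1 y.2).toReal := by
  classical
  rw [← ENNReal.toReal_mul]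
  congr 1
  rw [stepPMF, PMF.bind_apply, tsum_eq_single y.1]
  · congr 1
    rw [PMF.map_apply, tsum_eq_single y.2]
    · simp
    · intro a ha
      rw [if_neg fun h => ha (congrArg Prod.snd h).symm]
  · intro s' hs'
    rw [PMF.map_apply, ENNReal.tsum_eq_zero.2, mul_zero]
    intro a
    rw [if_neg fun h => hs' (congrArg Prod.fst h).symm]

section Averages

variable {S A : Type*} [Fintype A]

/-- The average of a function of the state and the action over the actions of a policy. -/
noncomputable def policyAvg (π : RandPolicy S A) (f : S → A → ℝ) : S → ℝ :=
  fun s => ∑ a, (π s a).toReal * f s a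

theorem policyAvg_mono (π : RandPolicy S A) {f g : S → A → ℝ} (h : ∀ s a, f s a ≤ g s a) :
    policyAvg π f ≤ policyAvg π g := fun s =>
  Finset.sum_le_sum fun a _ => mul_le_mul_of_nonneg_left (h s a) ENNReal.toReal_nonneg

theorem policyAvg_add (π : RandPolicy S A) (f g : S → A → ℝ) :
    policyAvg π (fun s a => f s a + g s a) = policyAvg π f + policyAvg π g := by
  ext s
  simp [policyAvg, mul_add, Finset.sum_add_distrib]

theorem policyAvg_sub (π : RandPolicy S A) (f g : S → A → ℝ) :
    policyAvg π (fun s a => f s a - g s a) = policyAvg π f - policyAvg π g := by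
  ext s
  simp [policyAvg, mul_sub, Finset.sum_sub_distrib]

theorem policyAvg_mul (π : RandPolicy S A) (c : ℝ) (f : S → A → ℝ) :
    policyAvg π (fun s a => c * f s a) = c • policyAvg π f := by
  ext s
  simp only [policyAvg, Pi.smul_apply, smul_eq_mul, Finset.mul_sum]
  exact Finset.sum_congr rfl fun _ _ => by ring

theorem policyAvg_state (π : RandPolicy S A) (v : S → ℝ) :
    policyAvg π (fun s _ => v s) = v := by
  ext s
  rw [policyAvg, ← Finset.sum_mul, PMF.sum_toReal_eq_one, one_mul]

theorem policyAvg_ofDet (d : S → A) (f : S → A → ℝ) (s : S) :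
    policyAvg (RandPolicy.ofDet d) f s = f s (d s) := by
  classical
  simp [policyAvg, RandPolicy.ofDet, PMF.pure_apply, apply_ite ENNReal.toReal, ite_mul]

end Averages

section Transitions

variable {S A : Type*} [Fintype S]

theorem expNext_mono (M : MDP S A) (s : S) (a : A) {v w : S → ℝ} (h : v ≤ w) :
    M.expNext s a v ≤ M.expNext s a w :=
  Finset.sum_le_sum fun s' _ => mul_le_mul_of_nonneg_left (h s') ENNReal.toReal_nonneg

theorem expNext_add (M : MDP S A) (s : S) (a : A) (v w : S → ℝ) :
    M.expNext s a (v + w) = M.expNext s a v + M.expNext s a w := by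
  simp [expNext, mul_add, Finset.sum_add_distrib]

theorem expNext_sub (M : MDP S A) (s : S) (a : A) (v w : S → ℝ) :
    M.expNext s a (v - w) = M.expNext s a v - M.expNext s a w := by
  simp [expNext, mul_sub, Finset.sum_sub_distrib]

theorem expNext_smul (M : MDP S A) (s : S) (a : A) (c : ℝ) (v : S → ℝ) :
    M.expNext s a (c • v) = c * M.expNext s a v := by
  simp only [expNext, Pi.smul_apply, smul_eq_mul, Finset.mul_sum]
  exact Finset.sum_congr rfl fun _ _ => by ring

theorem expNext_const (M : MDP S A) (s : S) (a : A) (c : ℝ) :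
    M.expNext s a (fun _ => c) = c := by
  rw [expNext, ← Finset.sum_mul, PMF.sum_toReal_eq_one, one_mul]

theorem continuous_expNext (M : MDP S A) (s : S) (a : A) :
    Continuous fun v => M.expNext s a v := by
  unfold expNext
  fun_prop

variable [Fintype A]

/-- The transition operator of the Markov chain on the states that a policy induces. -/
noncomputable def policyOp (M : MDP S A) (π : RandPolicy S A) : (S → ℝ) →ₗ[ℝ] (S → ℝ) where
  toFun v := policyAvg π fun s a => M.expNext s a v
  map_add' v w := by simp only [expNext_add, policyAvg_add]
  map_smul' c v := by simp only [expNext_smul, policyAvg_mul, RingHom.id_apply]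

theorem policyOp_apply (M : MDP S A) (π : RandPolicy S A) (v : S → ℝ) :
    M.policyOp π v = policyAvg π fun s a => M.expNext s a v := rfl

theorem policyOp_mono (M : MDP S A) (π : RandPolicy S A) : Monotone (M.policyOp π) :=
  fun _ _ h => policyAvg_mono π fun s a => M.expNext_mono s a h

theorem policyOp_one (M : MDP S A) (π : RandPolicy S A) : M.policyOp π 1 = 1 := by
  have h : (fun s a => M.expNext s a (1 : S → ℝ)) = fun (_ : S) (_ : A) => (1 : ℝ) := by
    ext s a
    exact M.expNext_const s a 1
  rw [policyOp_apply, h]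
  exact policyAvg_state π 1

end Transitions

section Trajectories

variable {S A : Type*} [Fintype S] [Fintype A] [MeasurableSpace S] [MeasurableSpace A]
  [DiscreteMeasurableSpace S] [DiscreteMeasurableSpace A]

instance (M : MDP S A) (π : RandPolicy S A) (s : S) : IsProbabilityMeasure (M.trajLaw π s) := by
  unfold trajLaw
  have := PMF.toMeasure.isProbabilityMeasure (initPMF π s)
  infer_instance

theorem integrable_comp_eval (M : MDP S A) (π : RandPolicy S A) (s : S) (n : ℕ)
    (f : S × A → ℝ) : Integrable (fun ω => f (ω n)) (M.trajLaw π s) := by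
  have hm : Measurable fun ω : ℕ → S × A => f (ω n) :=
    (measurable_of_countable f).comp (measurable_pi_apply n)
  refine Integrable.of_bound hm.aestronglyMeasurable (∑ x, ‖f x‖) (ae_of_all _ fun ω => ?_)
  exact Finset.single_le_sum (f := fun x => ‖f x‖) (fun x _ => norm_nonneg _)
    (Finset.mem_univ (ω n))

theorem integral_stepKernel (M : MDP S A) (π : RandPolicy S A) (f : S × A → ℝ) (x : S × A) :
    ∫ y, f y ∂(M.stepKernel π x)
      = M.expNext x.1 x.2 (policyAvg π fun s a => f (s, a)) := by
  have h : M.stepKernel π x = (M.stepPMF π x).toMeasure := rfl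
  rw [h, PMF.integral_eq_sum, Fintype.sum_prod_type]
  refine Finset.sum_congr rfl fun s' _ => ?_
  rw [policyAvg, Finset.mul_sum]
  refine Finset.sum_congr rfl fun a' _ => ?_
  rw [toReal_stepPMF_apply, smul_eq_mul, mul_assoc]

theorem integral_trajLaw_eval_zero (M : MDP S A) (π : RandPolicy S A) (s : S) (f : S × A → ℝ) :
    ∫ ω, f (ω 0) ∂(M.trajLaw π s) = policyAvg π (fun s a => f (s, a)) s := by
  have hlaw : (M.trajLaw π s).map (fun ω => ω 0) = (initPMF π s).toMeasure := by
    have := PMF.toMeasure.isProbabilityMeasure (initPMF π s)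
    have e1 : (fun ω : ℕ → S × A => ω 0)
        = (MeasurableEquiv.piUnique (fun _ : Finset.Iic 0 => S × A)) ∘
          Preorder.frestrictLe (π := fun _ => S × A) 0 := rfl
    rw [e1, ← Measure.map_map (by fun_prop) (by fun_prop), trajLaw, Kernel.trajMeasure,
      Measure.map_comp _ _ (by fun_prop), Kernel.traj_map_frestrictLe, Kernel.partialTraj_self,
      Measure.id_comp, Measure.map_map (by fun_prop) (by fun_prop)]
    convert Measure.map_id
    ext1 x
    exact (MeasurableEquiv.piUnique (fun _ : Finset.Iic 0 => S × A)).apply_symm_apply x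
  rw [← integral_map (φ := fun ω : ℕ → S × A => ω 0) (measurable_pi_apply 0).aemeasurable
    (measurable_of_countable f).aestronglyMeasurable, hlaw, initPMF,
    ← PMF.toMeasure_map _ _ (measurable_of_countable _),
    integral_map (measurable_of_countable _).aemeasurable
      (measurable_of_countable f).aestronglyMeasurable, PMF.integral_eq_sum]
  rfl

/-- The Markov property: disintegrate the law of history and next pair, with a kernel that sees only
the last pair. -/
theorem integral_trajLaw_eval_succ (M : MDP S A) (π : RandPolicy S A) (s : S) (n : ℕ)
    (f : S × A → ℝ) :
    ∫ ω, f (ω (n + 1)) ∂(M.trajLaw π s)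
      = ∫ ω, M.expNext (ω n).1 (ω n).2 (policyAvg π fun s a => f (s, a)) ∂(M.trajLaw π s) := by
  have := PMF.toMeasure.isProbabilityMeasure (initPMF π s)
  have hstep := Kernel.map_frestrictLe_trajMeasure_compProd_eq_map_trajMeasure
    (X := fun _ => S × A) (μ₀ := (initPMF π s).toMeasure) (κ := M.historyKernel π) (a := n)
  have hf : Measurable fun y : (∀ _ : Finset.Iic n, S × A) × (S × A) => f y.2 :=
    (measurable_of_countable f).comp measurable_snd
  have hpair : Measurable fun ω : ℕ → S × A =>
      (Preorder.frestrictLe (π := fun _ => S × A) n ω, ω (n + 1)) := by fun_prop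
  have hint : Integrable (fun y : (∀ _ : Finset.Iic n, S × A) × (S × A) => f y.2)
      ((M.trajLaw π s).map fun ω => (Preorder.frestrictLe (π := fun _ => S × A) n ω, ω (n + 1))) :=
    (integrable_map_measure hf.aestronglyMeasurable hpair.aemeasurable).2
      (M.integrable_comp_eval π s (n + 1) f)
  have h1 : ∫ ω, f (ω (n + 1)) ∂(M.trajLaw π s)
      = ∫ y, f y.2 ∂((M.trajLaw π s).map
          fun ω => (Preorder.frestrictLe (π := fun _ => S × A) n ω, ω (n + 1))) :=
    (integral_map hpair.aemeasurable hf.aestronglyMeasurable).symm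
  rw [h1]
  change Integrable _ ((Kernel.trajMeasure _ _).map _) at hint
  change ∫ y : (∀ _ : Finset.Iic n, S × A) × (S × A), f y.2 ∂((Kernel.trajMeasure _ _).map _) = _
  rw [← hstep] at hint ⊢
  rw [Measure.integral_compProd hint]
  have h2 : ∀ x : ∀ _ : Finset.Iic n, S × A, ∫ y, f y ∂(M.historyKernel π n x)
      = M.expNext (x ⟨n, Finset.mem_Iic.2 le_rfl⟩).1 (x ⟨n, Finset.mem_Iic.2 le_rfl⟩).2
          (policyAvg π fun s a => f (s, a)) := fun x => by
    rw [historyKernel, Kernel.comap_apply, integral_stepKernel]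
  simp only [h2]
  rw [integral_map (by fun_prop)]
  · rfl
  · exact ((measurable_of_countable fun x : S × A =>
      M.expNext x.1 x.2 (policyAvg π fun s a => f (s, a))).comp
      (measurable_pi_apply _)).aestronglyMeasurable

/-- The expectation of a function of `(S_n, A_n)`. -/
theorem integral_trajLaw_eval (M : MDP S A) (π : RandPolicy S A) (s : S) (n : ℕ)
    (f : S × A → ℝ) :
    ∫ ω, f (ω n) ∂(M.trajLaw π s)
      = ((M.policyOp π) ^ n) (policyAvg π fun s a => f (s, a)) s := by
  induction n generalizing f with
  | zero => simpa using M.integral_trajLaw_eval_zero π s f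
  | succ n ih =>
    rw [integral_trajLaw_eval_succ,
      ih fun x => M.expNext x.1 x.2 (policyAvg π fun s a => f (s, a)), pow_succ,
      Module.End.mul_apply, policyOp_apply]

theorem integral_trajLaw_sum (M : MDP S A) (π : RandPolicy S A) (s : S) (n : ℕ)
    (f : S × A → ℝ) :
    ∫ ω, (∑ t ∈ Finset.range n, f (ω t)) ∂(M.trajLaw π s)
      = ∑ t ∈ Finset.range n, ((M.policyOp π) ^ t) (policyAvg π fun s a => f (s, a)) s := by
  rw [integral_finsetSum _ fun t _ => M.integrable_comp_eval π s t f]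
  exact Finset.sum_congr rfl fun t _ => M.integral_trajLaw_eval π s t f

end Trajectories

end MDP

/-! ### Discounted values, gain and bias through the transition operator -/

theorem tendsto_one_div_mul_of_abs_sub_le {x : ℕ → ℝ} {l C : ℝ}
    (h : ∀ n : ℕ, |x n - n * l| ≤ C) :
    Tendsto (fun n : ℕ => (1 / (n : ℝ)) * x n) atTop (𝓝 l) := by
  rw [tendsto_iff_dist_tendsto_zero]
  refine squeeze_zero' (Eventually.of_forall fun _ => dist_nonneg) ?_
    (tendsto_const_div_atTop_nhds_zero_nat C)
  filter_upwards [eventually_gt_atTop 0] with n hn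
  have hn' : (0 : ℝ) < n := Nat.cast_pos.2 hn
  rw [Real.dist_eq, le_div_iff₀ hn', ← abs_of_pos hn', ← abs_mul, abs_of_pos hn']
  have : (1 / (n : ℝ) * x n - l) * n = x n - n * l := by field_simp
  rw [this]
  exact h n

/-- Subsolutions of the discounted evaluation equation lie below supersolutions. -/
theorem MarkovOperator.le_of_subsolution_of_supersolution {S : Type*} [Fintype S]
    {Q : (S → ℝ) →ₗ[ℝ] (S → ℝ)} (hmono : Monotone Q) (hone : Q 1 = 1) {γ : ℝ}
    (hγ0 : 0 ≤ γ) (hγ1 : γ < 1) {f V W : S → ℝ} (hV : V ≤ f + γ • Q V)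
    (hW : f + γ • Q W ≤ W) : V ≤ W := by
  rw [← sub_nonneg]
  refine MarkovOperator.nonneg_of_discount_le hmono hone hγ0 hγ1 ?_
  rw [map_sub, smul_sub]
  intro s
  have h1 := hV s
  have h2 := hW s
  simp only [Pi.add_apply, Pi.sub_apply] at h1 h2 ⊢
  linarith

namespace MDP

variable {S A : Type*} [Fintype S] [Fintype A]

theorem policyAvg_add_smul_policyOp (M : MDP S A) (π : RandPolicy S A) (c : S → A → ℝ) (γ : ℝ)
    (V : S → ℝ) :
    policyAvg π (fun s a => c s a + γ * M.expNext s a V)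
      = policyAvg π c + γ • M.policyOp π V := by
  rw [policyAvg_add, policyAvg_mul, policyOp_apply]

theorem policyAvg_add_smul_policyOp_le (M : MDP S A) (π : RandPolicy S A) {c : S → A → ℝ} {γ : ℝ}
    {V W : S → ℝ} (h : ∀ s a, c s a + γ * M.expNext s a V ≤ W s) :
    policyAvg π c + γ • M.policyOp π V ≤ W := by
  rw [← policyAvg_add_smul_policyOp]
  exact (policyAvg_mono π h).trans_eq (policyAvg_state π W)

theorem policyAvg_ofDet_add_smul_policyOp (M : MDP S A) {d : S → A} {c : S → A → ℝ} {γ : ℝ}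
    {V W : S → ℝ} (h : ∀ s, W s = c s (d s) + γ * M.expNext s (d s) V) :
    W = policyAvg (RandPolicy.ofDet d) c + γ • M.policyOp (RandPolicy.ofDet d) V := by
  rw [← policyAvg_add_smul_policyOp]
  ext s
  rw [policyAvg_ofDet, h s]

/-- The discounted optimality equation for a general reward function has a solution, and the
maximum is attained by a deterministic policy. -/
theorem exists_discounted_optimal [Nonempty A] (M : MDP S A) (c : S → A → ℝ) {γ : ℝ}
    (hγ0 : 0 ≤ γ) (hγ1 : γ < 1) :
    ∃ (V : S → ℝ) (d : S → A), (∀ s a, c s a + γ * M.expNext s a V ≤ V s) ∧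
      ∀ s, V s = c s (d s) + γ * M.expNext s (d s) V := by
  set F : (S → ℝ) → S → ℝ := fun V s => ⨆ a, (c s a + γ * M.expNext s a V) with hF
  have hle : ∀ V s a, c s a + γ * M.expNext s a V ≤ F V s := fun V s a =>
    le_ciSup (f := fun a => c s a + γ * M.expNext s a V) (Set.finite_range _).bddAbove a
  have hsub : ∀ V W s, F V s ≤ F W s + γ * dist V W := fun V W s => by
    refine ciSup_le fun a => ?_
    have h1 : V ≤ W + fun _ => dist V W := fun i => by
      have := (abs_le.1 ((Real.dist_eq _ _).symm.trans_le (dist_le_pi_dist V W i))).2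
      simp only [Pi.add_apply]
      linarith
    have h2 := M.expNext_mono s a h1
    rw [expNext_add, expNext_const] at h2
    have h3 := mul_le_mul_of_nonneg_left h2 hγ0
    have := hle W s a
    linarith
  have hcontr : ContractingWith ⟨γ, hγ0⟩ F := by
    refine ⟨hγ1, LipschitzWith.of_dist_le_mul fun V W => ?_⟩
    refine (dist_pi_le_iff (mul_nonneg hγ0 dist_nonneg)).2 fun s => ?_
    rw [Real.dist_eq, abs_le]
    have h1 := hsub V W s
    have h2 := hsub W V s
    rw [dist_comm] at h2
    constructor <;> linarith
  have hfix : F (ContractingWith.fixedPoint F hcontr) = ContractingWith.fixedPoint F hcontr :=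
    hcontr.fixedPoint_isFixedPt
  set V := ContractingWith.fixedPoint F hcontr
  have hatt : ∀ s, ∃ a, c s a + γ * M.expNext s a V = F V s := fun s =>
    exists_eq_ciSup_of_finite (f := fun a => c s a + γ * M.expNext s a V)
  choose d hd using hatt
  refine ⟨V, d, fun s a => ?_, fun s => ?_⟩
  · exact (hle V s a).trans_eq (congrFun hfix s)
  · rw [hd s, hfix]

variable [MeasurableSpace S] [MeasurableSpace A]
  [DiscreteMeasurableSpace S] [DiscreteMeasurableSpace A]

theorem value_eq_tsum (M : MDP S A) {γ : ℝ} (hγ0 : 0 ≤ γ) (hγ1 : γ < 1) (π : RandPolicy S A)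
    (s : S) :
    M.value γ π s = ∑' t : ℕ, γ ^ t * ((M.policyOp π) ^ t) (policyAvg π M.r) s := by
  have hint : ∀ t : ℕ, Integrable (fun ω : ℕ → S × A => γ ^ t * M.r (ω t).1 (ω t).2)
      (M.trajLaw π s) := fun t => M.integrable_comp_eval π s t fun x => γ ^ t * M.r x.1 x.2
  rw [value, ← integral_tsum_of_summable_integral_norm hint]
  · refine tsum_congr fun t => ?_
    rw [integral_const_mul, M.integral_trajLaw_eval π s t fun x => M.r x.1 x.2]
  · refine Summable.of_nonneg_of_le (fun t => integral_nonneg fun _ => norm_nonneg _)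
      (fun t => ?_) (summable_geometric_of_lt_one hγ0 hγ1)
    have h1 := integral_mono (hint t).norm (integrable_const (γ ^ t)) fun ω => by
      change ‖γ ^ t * M.r (ω t).1 (ω t).2‖ ≤ γ ^ t
      rw [Real.norm_of_nonneg (mul_nonneg (pow_nonneg hγ0 t) (M.r_nonneg _ _))]
      exact mul_le_of_le_one_right (pow_nonneg hγ0 t) (M.r_le_one _ _)
    simpa using h1

/-- The evaluation equation for the discounted value function. -/
theorem value_eq_add (M : MDP S A) {γ : ℝ} (hγ0 : 0 ≤ γ) (hγ1 : γ < 1) (π : RandPolicy S A) :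
    M.value γ π = policyAvg π M.r + γ • M.policyOp π (M.value γ π) := by
  have h : M.value γ π
      = fun s => ∑' t : ℕ, γ ^ t * ((M.policyOp π) ^ t) (policyAvg π M.r) s :=
    funext fun s => M.value_eq_tsum hγ0 hγ1 π s
  rw [h]
  exact MarkovOperator.tsum_eq_add γ _ fun s =>
    MarkovOperator.summable_discounted (M.policyOp_mono π) (M.policyOp_one π) hγ0 hγ1 _ s

theorem value_le (M : MDP S A) {γ : ℝ} (hγ0 : 0 ≤ γ) (hγ1 : γ < 1) (π : RandPolicy S A)
    {V : S → ℝ} (hV : ∀ s a, M.r s a + γ * M.expNext s a V ≤ V s) : M.value γ π ≤ V :=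
  MarkovOperator.le_of_subsolution_of_supersolution (M.policyOp_mono π) (M.policyOp_one π) hγ0 hγ1
    (M.value_eq_add hγ0 hγ1 π).le (M.policyAvg_add_smul_policyOp_le π hV)

theorem le_value (M : MDP S A) {γ : ℝ} (hγ0 : 0 ≤ γ) (hγ1 : γ < 1) (π : RandPolicy S A)
    {V : S → ℝ} (hV : V ≤ policyAvg π M.r + γ • M.policyOp π V) : V ≤ M.value γ π :=
  MarkovOperator.le_of_subsolution_of_supersolution (M.policyOp_mono π) (M.policyOp_one π) hγ0 hγ1
    hV (M.value_eq_add hγ0 hγ1 π).ge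

/-- The optimal discounted value function dominates all policies and satisfies the Bellman
inequality. -/
theorem optValue_spec [Nonempty A] (M : MDP S A) {γ : ℝ} (hγ0 : 0 ≤ γ) (hγ1 : γ < 1) :
    (∀ π, M.value γ π ≤ M.optValue γ) ∧ (∃ π, M.optValue γ = M.value γ π) ∧
      ∀ s a, M.r s a + γ * M.expNext s a (M.optValue γ) ≤ M.optValue γ s := by
  obtain ⟨V, d, hle, heq⟩ := M.exists_discounted_optimal M.r hγ0 hγ1
  have hval : M.value γ (RandPolicy.ofDet d) = V :=
    le_antisymm (M.value_le hγ0 hγ1 _ hle)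
      (M.le_value hγ0 hγ1 _ (M.policyAvg_ofDet_add_smul_policyOp heq).le)
  have hopt : M.optValue γ = V := by
    ext s
    refine IsLUB.csSup_eq (IsGreatest.isLUB ⟨⟨_, congrFun hval s⟩, ?_⟩) (Set.range_nonempty _)
    rintro _ ⟨π, rfl⟩
    exact M.value_le hγ0 hγ1 π hle s
  rw [hopt]
  exact ⟨fun π => M.value_le hγ0 hγ1 π hle, ⟨_, hval.symm⟩, hle⟩

/-- The gain of a policy is the fixed part of its mean reward. -/
theorem gain_eq (M : MDP S A) (π : RandPolicy S A) {ρ g : S → ℝ} (hρ : M.policyOp π ρ = ρ)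
    (hg : policyAvg π M.r = ρ + g - M.policyOp π g) : M.gain π = ρ := by
  ext s
  -- With `Q` the transition operator, the expected reward over `n` steps is `n ρ + g - Q ^ n g`.
  refine Tendsto.limUnder_eq (tendsto_one_div_mul_of_abs_sub_le (C := 2 * ‖g‖) fun n => ?_)
  rw [M.integral_trajLaw_sum π s n fun x => M.r x.1 x.2]
  have hsum := congrFun (MarkovOperator.sum_pow_sub (Q := M.policyOp π) g n) s
  rw [Finset.sum_apply] at hsum
  have hterm : ∀ t, ((M.policyOp π) ^ t) (policyAvg π M.r) s
      = ρ s + ((M.policyOp π) ^ t) (g - M.policyOp π g) s := fun t => by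
    rw [hg, add_sub_assoc, map_add, MarkovOperator.pow_apply_of_fixed hρ, Pi.add_apply]
  have h1 : |((M.policyOp π) ^ n) g s| ≤ ‖g‖ := (norm_le_pi_norm _ s).trans
    (MarkovOperator.norm_pow_apply_le (M.policyOp_mono π) (M.policyOp_one π) g n)
  have h2 : |g s| ≤ ‖g‖ := norm_le_pi_norm g s
  simp only [hterm]
  rw [Finset.sum_add_distrib, hsum, Finset.sum_const, Finset.card_range, nsmul_eq_mul,
    add_sub_cancel_left, Pi.sub_apply]
  linarith [abs_sub (g s) (((M.policyOp π) ^ n) g s)]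

/-- The bias of a policy is the normalized solution of the Poisson equation. -/
theorem bias_eq (M : MDP S A) (π : RandPolicy S A) {ρ w : S → ℝ} (hρ : M.policyOp π ρ = ρ)
    (hw : policyAvg π M.r = ρ + (w - M.policyOp π w) - M.policyOp π (w - M.policyOp π w)) :
    M.bias π = w - M.policyOp π w := by
  ext s
  -- With `Q` the transition operator and `g = w - Q w`, the centred sums equal `g - Q ^ T g`.
  -- Periodicity may keep `Q ^ T g` from converging, but `g` is a coboundary, so its sums over `T`
  -- telescope and its Cesàro means vanish.
  refine Tendsto.limUnder_eq (tendsto_one_div_mul_of_abs_sub_le (C := 2 * ‖w‖) fun n => ?_)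
  have hterm : ∀ T : ℕ,
      ∫ ω, (∑ t ∈ Finset.range T, (M.r (ω t).1 (ω t).2 - M.gain π (ω t).1)) ∂(M.trajLaw π s)
        = (w - M.policyOp π w) s - ((M.policyOp π) ^ T) (w - M.policyOp π w) s := fun T => by
    rw [M.integral_trajLaw_sum π s T fun x => M.r x.1 x.2 - M.gain π x.1]
    have h0 : policyAvg π (fun s a => M.r s a - M.gain π s)
        = (w - M.policyOp π w) - M.policyOp π (w - M.policyOp π w) := by
      rw [policyAvg_sub, policyAvg_state, M.gain_eq π hρ hw, hw]
      abel
    have hsum := congrFun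
      (MarkovOperator.sum_pow_sub (Q := M.policyOp π) (w - M.policyOp π w) T) s
    rw [Finset.sum_apply, Pi.sub_apply] at hsum
    simp only [h0]
    exact hsum
  have hsum := congrFun (MarkovOperator.sum_pow_sub (Q := M.policyOp π) w n) s
  rw [Finset.sum_apply] at hsum
  have h1 : |((M.policyOp π) ^ n) w s| ≤ ‖w‖ := (norm_le_pi_norm _ s).trans
    (MarkovOperator.norm_pow_apply_le (M.policyOp_mono π) (M.policyOp_one π) w n)
  have h2 : |w s| ≤ ‖w‖ := norm_le_pi_norm w s
  simp only [hterm]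
  rw [Finset.sum_sub_distrib, hsum, Finset.sum_const, Finset.card_range, nsmul_eq_mul,
    sub_right_comm, sub_self, zero_sub, abs_neg, Pi.sub_apply]
  linarith [abs_sub (w s) (((M.policyOp π) ^ n) w s)]

end MDP

/-! ### Comparison of orders at zero, and the span -/

/-- Used with `x = 1 - γ` on inequalities already multiplied by `x`: `a` is the coefficient of `1 /
x`. When `a = 0`, the next lemma reads off the constant term. -/
theorem nonpos_of_eventually_le_mul {a : ℝ} {φ : ℝ → ℝ} (hφ : Continuous φ)
    (h : ∀ᶠ x in 𝓝[>] (0 : ℝ), a ≤ x * φ x) : a ≤ 0 := by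
  have hc : Continuous fun x => x * φ x := by fun_prop
  have ht : Tendsto (fun x => x * φ x) (𝓝[>] (0 : ℝ)) (𝓝 (0 * φ 0)) :=
    (hc.tendsto 0).mono_left nhdsWithin_le_nhds
  rw [zero_mul] at ht
  exact ge_of_tendsto ht h

theorem nonneg_of_eventually_nonneg_mul {φ : ℝ → ℝ} (hφ : Continuous φ)
    (h : ∀ᶠ x in 𝓝[>] (0 : ℝ), 0 ≤ x * φ x) : 0 ≤ φ 0 := by
  have ht : Tendsto φ (𝓝[>] (0 : ℝ)) (𝓝 (φ 0)) := (hφ.tendsto 0).mono_left nhdsWithin_le_nhds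
  refine ge_of_tendsto ht ?_
  filter_upwards [h, self_mem_nhdsWithin] with x hx hx0
  exact nonneg_of_mul_nonneg_right hx hx0

theorem le_iSup_of_finite {S : Type*} [Finite S] (v : S → ℝ) (s : S) : v s ≤ ⨆ s, v s :=
  le_ciSup (Set.finite_range v).bddAbove s

theorem iInf_le_of_finite {S : Type*} [Finite S] (v : S → ℝ) (s : S) : ⨅ s, v s ≤ v s :=
  ciInf_le (Set.finite_range v).bddBelow s

theorem sub_le_spanSeminorm {S : Type*} [Finite S] (v : S → ℝ) (s s' : S) :
    v s - v s' ≤ spanSeminorm v :=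
  sub_le_sub (le_iSup_of_finite v s) (iInf_le_of_finite v s')

theorem spanSeminorm_nonneg {S : Type*} [Finite S] [Nonempty S] (v : S → ℝ) :
    0 ≤ spanSeminorm v := by
  obtain ⟨s⟩ := ‹Nonempty S›
  simpa using sub_le_spanSeminorm v s s

/-! ### Two-sided bounds for value iterates and for the optimal discounted value -/

namespace MDP

variable {S A : Type*} [Fintype S]

/-- The bound is propagated by one Bellman step; subtracting `m` makes it hold at the zero vector.
The lower bound below is the mirror image along one policy. -/
theorem iterate_bellman_le [Nonempty A] (M : MDP S A) {ρ g : S → ℝ} {m : ℝ}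
    (hρ : ∀ s a, M.expNext s a ρ ≤ ρ s) (hg : ∀ s a, M.r s a + M.expNext s a g ≤ ρ s + g s)
    (hm : ∀ s, m ≤ g s) (t : ℕ) :
    (M.bellman 1)^[t] 0 ≤ (t : ℝ) • ρ + g - fun _ => m := by
  induction t with
  | zero =>
    intro s
    simpa using hm s
  | succ t ih =>
    intro s
    rw [Function.iterate_succ_apply']
    refine ciSup_le fun a => ?_
    have h1 := M.expNext_mono s a ih
    rw [expNext_sub, expNext_add, expNext_smul, expNext_const] at h1
    have h2 := mul_le_mul_of_nonneg_left (hρ s a) (Nat.cast_nonneg (α := ℝ) t)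
    have h3 := hg s a
    simp only [Pi.sub_apply, Pi.add_apply, Pi.smul_apply, smul_eq_mul, Nat.cast_add, Nat.cast_one]
    linarith

variable [Fintype A]

theorem le_bellman (M : MDP S A) (γ : ℝ) (V : S → ℝ) (s : S) (a : A) :
    M.r s a + γ * M.expNext s a V ≤ M.bellman γ V s :=
  le_iSup_of_finite (fun a => M.r s a + γ * M.expNext s a V) a

theorem le_iterate_bellman (M : MDP S A) (π : RandPolicy S A) {ρ g : S → ℝ} {m : ℝ}
    (hρ : M.policyOp π ρ = ρ) (hg : policyAvg π M.r = ρ + g - M.policyOp π g)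
    (hm : ∀ s, g s ≤ m) (t : ℕ) :
    ((t : ℝ) • ρ + g - fun _ => m) ≤ (M.bellman 1)^[t] 0 := by
  induction t with
  | zero =>
    intro s
    simpa using hm s
  | succ t ih =>
    rw [Function.iterate_succ_apply']
    set V := (M.bellman 1)^[t] 0
    have h1 := M.policyOp_mono π ih
    rw [map_sub, map_add, map_smul, hρ, MarkovOperator.map_const (M.policyOp_one π)] at h1
    have h2 := M.policyAvg_add_smul_policyOp_le π (M.le_bellman 1 V)
    intro s
    have h1s := h1 s
    have h2s := h2 s
    rw [hg] at h2s
    simp only [Pi.sub_apply, Pi.add_apply, Pi.smul_apply, smul_eq_mul, Nat.cast_add,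
      Nat.cast_one] at h1s h2s ⊢
    linarith

variable [MeasurableSpace S] [MeasurableSpace A]
  [DiscreteMeasurableSpace S] [DiscreteMeasurableSpace A]

/-- The right side is a supersolution of the discounted equation: discounting `g - m` only helps,
since it is nonnegative. -/
theorem optValue_le [Nonempty A] (M : MDP S A) {γ : ℝ} (hγ0 : 0 ≤ γ) (hγ1 : γ < 1)
    {ρ g : S → ℝ} {m : ℝ} (hρ : ∀ s a, M.expNext s a ρ ≤ ρ s)
    (hg : ∀ s a, M.r s a + M.expNext s a g ≤ ρ s + g s) (hm : ∀ s, m ≤ g s) :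
    M.optValue γ ≤ (1 - γ)⁻¹ • ρ + g - fun _ => m := by
  obtain ⟨π, hπ⟩ := (M.optValue_spec hγ0 hγ1).2.1
  rw [hπ]
  have hγ : 0 < 1 - γ := by linarith
  refine M.value_le hγ0 hγ1 π fun s a => ?_
  rw [expNext_sub, expNext_add, expNext_smul, expNext_const]
  simp only [Pi.sub_apply, Pi.add_apply, Pi.smul_apply, smul_eq_mul]
  have hc : (1 - γ)⁻¹ * (1 - γ) = 1 := inv_mul_cancel₀ hγ.ne'
  have h1 := mul_le_mul_of_nonneg_left (hρ s a) (mul_nonneg hγ0 (inv_nonneg.2 hγ.le))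
  have h2 : γ * (1 - γ)⁻¹ * ρ s = (1 - γ)⁻¹ * ρ s - ρ s := by
    linear_combination (-ρ s) * hc
  have h3 : m ≤ M.expNext s a g := by
    have := M.expNext_mono s a (v := fun _ => m) (w := g) hm
    rwa [expNext_const] at this
  have h4 := mul_le_mul_of_nonneg_left h3 hγ.le
  have h5 := hg s a
  linarith

theorem le_optValue [Nonempty A] (M : MDP S A) {γ : ℝ} (hγ0 : 0 ≤ γ) (hγ1 : γ < 1)
    (π : RandPolicy S A) {ρ g : S → ℝ} {m : ℝ} (hρ : M.policyOp π ρ = ρ)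
    (hg : policyAvg π M.r = ρ + g - M.policyOp π g) (hm : ∀ s, g s ≤ m) :
    ((1 - γ)⁻¹ • ρ + g - fun _ => m) ≤ M.optValue γ := by
  refine le_trans ?_ ((M.optValue_spec hγ0 hγ1).1 π)
  have hγ : 0 < 1 - γ := by linarith
  refine M.le_value hγ0 hγ1 π ?_
  have h1 := M.policyOp_mono π (a := g) (b := fun _ => m) hm
  rw [map_sub, map_add, map_smul, hρ, hg]
  rw [MarkovOperator.map_const (M.policyOp_one π)] at h1 ⊢
  intro s
  have hc : (1 - γ)⁻¹ * (1 - γ) = 1 := inv_mul_cancel₀ hγ.ne'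
  have h2 : γ * (1 - γ)⁻¹ * ρ s = (1 - γ)⁻¹ * ρ s - ρ s := by
    linear_combination (-ρ s) * hc
  have h4 := mul_le_mul_of_nonneg_left (h1 s) hγ.le
  simp only [Pi.sub_apply, Pi.add_apply, Pi.smul_apply, smul_eq_mul]
  linarith

/-- A pair `(ρ, g')` of supersolutions of the optimality equations and a policy whose gain and
Poisson potential are `(ρ, g)` control the distance of the normalized value iterates to the
optimal discounted value function. -/
theorem norm_iterate_bellman_sub_optValue_le [Nonempty S] [Nonempty A] (M : MDP S A) {γ : ℝ}
    (hγ0 : 0 ≤ γ) (hγ1 : γ < 1) (π : RandPolicy S A) {ρ g g' : S → ℝ} {K : ℝ}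
    (hρ : M.policyOp π ρ = ρ) (hg : policyAvg π M.r = ρ + g - M.policyOp π g)
    (hρ' : ∀ s a, M.expNext s a ρ ≤ ρ s)
    (hg' : ∀ s a, M.r s a + M.expNext s a g' ≤ ρ s + g' s)
    (hK : spanSeminorm g ≤ K) (hK' : ∀ s s', g' s - g' s' ≤ K)
    {t : ℕ} (ht0 : 0 < t) (ht : (t : ℝ) ≤ 1 / (1 - γ)) :
    ‖(1 / ((t : ℝ) * (1 - γ))) • (M.bellman 1)^[t] 0 - M.optValue γ‖
      ≤ 2 * (K / (t : ℝ)) * (1 / (1 - γ)) := by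
  have hγ : 0 < 1 - γ := by linarith
  have htpos : (0 : ℝ) < t := Nat.cast_pos.2 ht0
  have hK0 : 0 ≤ K := (spanSeminorm_nonneg g).trans hK
  obtain ⟨s₀, hs₀⟩ := Finite.exists_min g'
  refine (pi_norm_le_iff_of_nonneg (by positivity)).2 fun s => ?_
  have u1 := M.iterate_bellman_le hρ' hg' hs₀ t s
  have u2 := M.optValue_le hγ0 hγ1 hρ' hg' hs₀ s
  have l1 := M.le_iterate_bellman π hρ hg (le_iSup_of_finite g) t s
  have l2 := M.le_optValue hγ0 hγ1 π hρ hg (le_iSup_of_finite g) s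
  have k1 := hK' s s₀
  have k2 : (⨆ s, g s) - g s ≤ K :=
    (sub_le_sub_left (iInf_le_of_finite g s) _).trans hK
  simp only [Pi.sub_apply, Pi.add_apply, Pi.smul_apply, smul_eq_mul] at u1 u2 l1 l2 ⊢
  set x := (M.bellman 1)^[t] 0 s
  set y := M.optValue γ s
  set c := (1 - γ)⁻¹ with hc
  have hx : |x - t * ρ s| ≤ K := abs_le.2 ⟨by linarith, by linarith⟩
  have hy : |y - c * ρ s| ≤ K := abs_le.2 ⟨by linarith, by linarith⟩
  have hp : 0 < (t : ℝ) * (1 - γ) := by positivity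
  have hp1 : (t : ℝ) * (1 - γ) ≤ 1 := by rwa [le_div_iff₀ hγ] at ht
  -- The only use of `t ≤ 1 / (1 - γ)`: the unscaled error of the optimal value is absorbed into the
  -- scaled one.
  have hone : 1 ≤ 1 / ((t : ℝ) * (1 - γ)) := by rwa [le_div_iff₀ hp, one_mul]
  have hsplit : 1 / ((t : ℝ) * (1 - γ)) * x - y
      = 1 / ((t : ℝ) * (1 - γ)) * (x - t * ρ s) - (y - c * ρ s) := by
    rw [hc]
    field_simp
    ring
  have hrhs : 2 * (K / (t : ℝ)) * (1 / (1 - γ))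
      = 1 / ((t : ℝ) * (1 - γ)) * K + 1 / ((t : ℝ) * (1 - γ)) * K := by
    field_simp
    ring
  rw [hsplit, hrhs, Real.norm_eq_abs]
  refine (abs_sub _ _).trans (add_le_add ?_ ?_)
  · rw [abs_mul, abs_of_pos (by positivity : 0 < 1 / ((t : ℝ) * (1 - γ)))]
    exact mul_le_mul_of_nonneg_left hx (by positivity)
  · exact hy.trans (le_mul_of_one_le_left hK0 hone)

end MDP

/-! ### The gain-dropping time and its potential -/

namespace MDP

variable {S A : Type*} [Fintype S]

open scoped Classical in
/-- The cost that counts the uses of gain-dropping actions for a gain vector `ρ`. -/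
noncomputable def dropCost (M : MDP S A) (ρ : S → ℝ) (s : S) (a : A) : ℝ :=
  if M.expNext s a ρ < ρ s then 1 else 0

theorem dropCost_nonneg (M : MDP S A) (ρ : S → ℝ) (s : S) (a : A) : 0 ≤ M.dropCost ρ s a := by
  unfold dropCost
  split_ifs <;> norm_num

variable [Fintype A]

/-- The expected number of gain-dropping actions is bounded uniformly over all policies. -/
theorem exists_sum_dropCost_le (M : MDP S A) {ρ : S → ℝ}
    (hρ : ∀ s a, M.expNext s a ρ ≤ ρ s) :
    ∃ C : ℝ, ∀ (π : RandPolicy S A) (s : S) (n : ℕ),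
      ∑ k ∈ Finset.range n, ((M.policyOp π) ^ k) (policyAvg π (M.dropCost ρ)) s ≤ C := by
  classical
  obtain ⟨δ, hδ0, hδ⟩ : ∃ δ : ℝ, 0 < δ ∧
      ∀ s a, M.expNext s a ρ < ρ s → δ ≤ ρ s - M.expNext s a ρ := by
    rcases isEmpty_or_nonempty (S × A) with he | hne
    · exact ⟨1, one_pos, fun s a => (he.false (s, a)).elim⟩
    -- The value 1 at pairs that do not drop the gain keeps the minimum `δ` positive.
    · obtain ⟨x₀, hx₀⟩ := Finite.exists_min fun x : S × A =>
        if M.expNext x.1 x.2 ρ < ρ x.1 then ρ x.1 - M.expNext x.1 x.2 ρ else 1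
      refine ⟨_, ?_, fun s a h => (hx₀ (s, a)).trans_eq (if_pos h)⟩
      split_ifs with h
      · exact sub_pos.2 h
      · exact one_pos
  refine ⟨δ⁻¹ * (2 * ‖ρ‖), fun π s n => ?_⟩
  -- Every drop costs at least `δ` of gain, so the count is dominated by a telescoping sum.
  have hc : policyAvg π (M.dropCost ρ) ≤ δ⁻¹ • (ρ - M.policyOp π ρ) := by
    have h1 : policyAvg π (M.dropCost ρ)
        ≤ policyAvg π fun s a => δ⁻¹ * (ρ s - M.expNext s a ρ) := by
      refine policyAvg_mono π fun s a => ?_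
      unfold dropCost
      split_ifs with h
      · rw [inv_mul_eq_div, le_div_iff₀ hδ0, one_mul]
        exact hδ s a h
      · exact mul_nonneg (inv_nonneg.2 hδ0.le) (sub_nonneg.2 (hρ s a))
    rwa [policyAvg_mul, policyAvg_sub, policyAvg_state, ← policyOp_apply] at h1
  have hk : ∀ k, ((M.policyOp π) ^ k) (policyAvg π (M.dropCost ρ)) s
      ≤ δ⁻¹ * ((M.policyOp π) ^ k) (ρ - M.policyOp π ρ) s := fun k => by
    have := MarkovOperator.pow_nonneg (M.policyOp_mono π) (sub_nonneg.2 hc) k s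
    rw [map_sub, map_smul] at this
    simpa using this
  have hsum := congrFun (MarkovOperator.sum_pow_sub (Q := M.policyOp π) ρ n) s
  rw [Finset.sum_apply, Pi.sub_apply] at hsum
  refine (Finset.sum_le_sum fun k _ => hk k).trans ?_
  rw [← Finset.mul_sum, hsum]
  refine mul_le_mul_of_nonneg_left ?_ (inv_nonneg.2 hδ0.le)
  have h1 : |((M.policyOp π) ^ n) ρ s| ≤ ‖ρ‖ := (norm_le_pi_norm _ s).trans
    (MarkovOperator.norm_pow_apply_le (M.policyOp_mono π) (M.policyOp_one π) ρ n)
  have h2 : |ρ s| ≤ ‖ρ‖ := norm_le_pi_norm ρ s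
  linarith [(abs_le.1 h1).1, (abs_le.1 h2).2]

theorem pow_policyOp_dropCost_nonneg (M : MDP S A) (π : RandPolicy S A) (ρ : S → ℝ) (k : ℕ)
    (s : S) : 0 ≤ ((M.policyOp π) ^ k) (policyAvg π (M.dropCost ρ)) s := by
  refine MarkovOperator.pow_nonneg (M.policyOp_mono π) ?_ k s
  have h := policyAvg_mono π (f := fun _ _ => 0) (M.dropCost_nonneg ρ)
  rwa [policyAvg_state π fun _ => 0] at h

variable [MeasurableSpace S] [MeasurableSpace A]
  [DiscreteMeasurableSpace S] [DiscreteMeasurableSpace A]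

theorem policyDropTime_eq (M : MDP S A) (π : RandPolicy S A) :
    M.policyDropTime π = ⨆ s, ∑' t : ℕ,
      ENNReal.ofReal (((M.policyOp π) ^ t) (policyAvg π (M.dropCost M.optGain)) s) := by
  refine iSup_congr fun s => ?_
  have hind : ∀ x : S × A, {x : S × A | M.expNext x.1 x.2 M.optGain < M.optGain x.1}.indicator
      (fun _ => (1 : ℝ≥0∞)) x = ENNReal.ofReal (M.dropCost M.optGain x.1 x.2) := fun x => by
    classical
    rw [Set.indicator_apply, dropCost]
    by_cases h : M.expNext x.1 x.2 M.optGain < M.optGain x.1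
    · simp [h]
    · simp [h]
  simp only [hind]
  have hm : ∀ t : ℕ, AEMeasurable
      (fun ω : ℕ → S × A => ENNReal.ofReal (M.dropCost M.optGain (ω t).1 (ω t).2))
      (M.trajLaw π s) := fun t => ((measurable_of_countable fun x : S × A =>
    ENNReal.ofReal (M.dropCost M.optGain x.1 x.2)).comp (measurable_pi_apply t)).aemeasurable
  rw [lintegral_tsum hm]
  refine tsum_congr fun t => ?_
  rw [← M.integral_trajLaw_eval π s t fun x => M.dropCost M.optGain x.1 x.2,
    ofReal_integral_eq_lintegral_ofReal
      (M.integrable_comp_eval π s t fun x => M.dropCost M.optGain x.1 x.2)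
      (ae_of_all _ fun ω => M.dropCost_nonneg _ _ _)]

theorem dropTime_ne_top (M : MDP S A)
    (hρ : ∀ s a, M.expNext s a M.optGain ≤ M.optGain s) : M.dropTime ≠ ∞ := by
  obtain ⟨C, hC⟩ := M.exists_sum_dropCost_le hρ
  refine ne_top_of_le_ne_top (ENNReal.ofReal_ne_top (r := C)) (iSup_le fun d => ?_)
  rw [policyDropTime_eq]
  refine iSup_le fun s => ?_
  have hnn := M.pow_policyOp_dropCost_nonneg (RandPolicy.ofDet d) M.optGain
  rw [← ENNReal.ofReal_tsum_of_nonneg (fun k => hnn k s)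
    (summable_of_sum_range_le (fun k => hnn k s) (hC _ s))]
  exact ENNReal.ofReal_le_ofReal (Real.tsum_le_of_sum_range_le (fun k => hnn k s) (hC _ s))

/-- Discounting makes the optimal drop count a fixed point attained by a deterministic policy; its
undiscounted count `H` dominates it and is at most `dropTime`. -/
theorem exists_discounted_dropTime [Nonempty A] (M : MDP S A)
    (hρ : ∀ s a, M.expNext s a M.optGain ≤ M.optGain s) {γ : ℝ} (hγ0 : 0 ≤ γ) (hγ1 : γ < 1) :
    ∃ V : S → ℝ, V ∈ Set.Icc (0 : S → ℝ) (fun _ => M.dropTime.toReal) ∧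
      ∀ s a, M.dropCost M.optGain s a + γ * M.expNext s a V ≤ V s := by
  obtain ⟨V, d, hle, heq⟩ := M.exists_discounted_optimal (M.dropCost M.optGain) hγ0 hγ1
  obtain ⟨C, hC⟩ := M.exists_sum_dropCost_le hρ
  set π := RandPolicy.ofDet d
  have hmono := M.policyOp_mono π
  have hone := M.policyOp_one π
  have hnn := M.pow_policyOp_dropCost_nonneg π M.optGain
  have hsum : ∀ s, Summable fun k : ℕ =>
      ((M.policyOp π) ^ k) (policyAvg π (M.dropCost M.optGain)) s := fun s =>
    summable_of_sum_range_le (fun k => hnn k s) (hC π s)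
  set H : S → ℝ := fun s => ∑' k : ℕ,
    ((M.policyOp π) ^ k) (policyAvg π (M.dropCost M.optGain)) s with hH
  have hH0 : 0 ≤ H := fun s => tsum_nonneg fun k => hnn k s
  have hHeq : H = policyAvg π (M.dropCost M.optGain) + M.policyOp π H := by
    simpa using MarkovOperator.tsum_eq_add (Q := M.policyOp π) 1
      (policyAvg π (M.dropCost M.optGain)) (by simpa using hsum)
  have hVeq := M.policyAvg_ofDet_add_smul_policyOp heq
  have hVH : V ≤ H := by
    refine MarkovOperator.le_of_subsolution_of_supersolution hmono hone hγ0 hγ1 hVeq.le ?_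
    conv_rhs => rw [hHeq]
    have hQH : 0 ≤ M.policyOp π H := by simpa using hmono hH0
    intro s
    have := mul_le_of_le_one_left (hQH s) hγ1.le
    simp only [Pi.add_apply, Pi.smul_apply, smul_eq_mul]
    linarith
  refine ⟨V, ⟨?_, fun s => (hVH s).trans ?_⟩, hle⟩
  · refine MarkovOperator.nonneg_of_discount_le hmono hone hγ0 hγ1 ?_
    conv_rhs => rw [hVeq]
    intro s
    have := hnn 0 s
    rw [pow_zero, Module.End.one_apply] at this
    exact le_add_of_nonneg_left this
  · refine (ENNReal.ofReal_le_iff_le_toReal (M.dropTime_ne_top hρ)).1 ?_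
    rw [hH, ENNReal.ofReal_tsum_of_nonneg (fun k => hnn k s) (hsum s)]
    refine le_trans ?_ (le_iSup (fun d => M.policyDropTime (RandPolicy.ofDet d)) d)
    rw [policyDropTime_eq]
    exact le_iSup (fun s => ∑' t : ℕ, ENNReal.ofReal
      (((M.policyOp π) ^ t) (policyAvg π (M.dropCost M.optGain)) s)) s

/-- A potential for the number of gain-dropping actions that is valid for all actions at once and
is bounded by the gain-dropping time over deterministic policies. -/
theorem exists_dropTime_potential [Nonempty A] (M : MDP S A)
    (hρ : ∀ s a, M.expNext s a M.optGain ≤ M.optGain s) :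
    ∃ U : S → ℝ, U ∈ Set.Icc (0 : S → ℝ) (fun _ => M.dropTime.toReal) ∧
      ∀ s a, M.dropCost M.optGain s a + M.expNext s a U ≤ U s := by
  have hγ0 : ∀ n : ℕ, (0 : ℝ) ≤ 1 - 1 / ((n : ℝ) + 1) := fun n => by
    rw [sub_nonneg, div_le_one (by positivity)]
    linarith [Nat.cast_nonneg (α := ℝ) n]
  have hγ1 : ∀ n : ℕ, 1 - 1 / ((n : ℝ) + 1) < 1 := fun n => by
    have : 0 < 1 / ((n : ℝ) + 1) := by positivity
    linarith
  choose V hV hVle using fun n => M.exists_discounted_dropTime hρ (hγ0 n) (hγ1 n)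
  -- The bound on the potentials does not depend on the discount factor, so a subsequence converges
  -- as the factor tends to 1 and the inequality survives.
  obtain ⟨U, hU, φ, hφ, hlim⟩ := isCompact_Icc.tendsto_subseq hV
  refine ⟨U, hU, fun s a => ?_⟩
  have hγ : Tendsto (fun n : ℕ => 1 - 1 / ((n : ℝ) + 1)) atTop (𝓝 1) := by
    simpa using (tendsto_const_nhds (x := (1 : ℝ))).sub
      (tendsto_one_div_add_atTop_nhds_zero_nat (𝕜 := ℝ))
  have hE := ((M.continuous_expNext s a).tendsto U).comp hlim
  have h1 := ((hγ.comp hφ.tendsto_atTop).mul hE).const_add (M.dropCost M.optGain s a)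
  rw [one_mul] at h1
  exact le_of_tendsto_of_tendsto' h1 (tendsto_pi_nhds.1 hlim s) fun n => hVle (φ n) s a

/-! ### Blackwell optimality and the optimality equations -/

/-- The gain and the bias of a Blackwell-optimal policy solve the unmodified optimality equations,
and its gain is optimal and nonnegative. -/
theorem IsBlackwellOptimal.spec [Nonempty A] {M : MDP S A} {π : RandPolicy S A}
    (h : M.IsBlackwellOptimal π) :
    0 ≤ M.optGain ∧ M.policyOp π M.optGain = M.optGain ∧
    policyAvg π M.r = M.optGain + M.bias π - M.policyOp π (M.bias π) ∧
    (∀ s a, M.expNext s a M.optGain ≤ M.optGain s) ∧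
    ∀ s a, M.expNext s a M.optGain = M.optGain s →
      M.r s a + M.expNext s a (M.bias π) ≤ M.optGain s + M.bias π s := by
  obtain ⟨γ₀, hγ₀, hopt⟩ := h
  have hnear : ∀ᶠ x in 𝓝[>] (0 : ℝ), 0 < x ∧ x < 1 ∧ M.value (1 - x) π = M.optValue (1 - x) := by
    have hpos : (0 : ℝ) < min 1 (1 - γ₀) := lt_min one_pos (by linarith)
    filter_upwards [Ioo_mem_nhdsGT hpos] with x hx
    have h1 := hx.2.trans_le (min_le_left _ _)
    have h2 := hx.2.trans_le (min_le_right _ _)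
    exact ⟨hx.1, h1, hopt _ (by linarith) (by linarith) (by linarith [hx.1])⟩
  have hlaurent : ∀ π' : RandPolicy S A, ∃ ρ w : S → ℝ, M.policyOp π' ρ = ρ ∧
      policyAvg π' M.r = ρ + (w - M.policyOp π' w) - M.policyOp π' (w - M.policyOp π' w) ∧
      ∀ x s, 0 < x → x < 1 →
        |M.value (1 - x) π' s - ρ s / x - (w - M.policyOp π' w) s| ≤ 2 * x * ‖w‖ := fun π' => by
    obtain ⟨ρ, w, hρ, hw⟩ := MarkovOperator.exists_ergodic_decomposition (M.policyOp_mono π')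
      (M.policyOp_one π') (policyAvg π' M.r)
    refine ⟨ρ, w, hρ, hw, fun x s hx0 hx1 => ?_⟩
    have hv := M.value_eq_add (γ := 1 - x) (by linarith) (by linarith) π'
    simpa using MarkovOperator.abs_sub_laurent_le (M.policyOp_mono π') (M.policyOp_one π')
      (by linarith) (by linarith) hρ hw hv s
  obtain ⟨ρ, w, hρ, hw, hlau⟩ := hlaurent π
  have hbias := M.bias_eq π hρ hw
  have hgain : M.optGain = ρ := by
    ext s
    refine IsLUB.csSup_eq (IsGreatest.isLUB ⟨⟨π, congrFun (M.gain_eq π hρ hw) s⟩, ?_⟩)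
      (Set.range_nonempty _)
    rintro _ ⟨π', rfl⟩
    obtain ⟨ρ', w', hρ', hw', hlau'⟩ := hlaurent π'
    change M.gain π' s ≤ ρ s
    rw [M.gain_eq π' hρ' hw', ← sub_nonpos]
    refine nonpos_of_eventually_le_mul (φ := fun x => (w - M.policyOp π w) s + 2 * x * ‖w‖
      - (w' - M.policyOp π' w') s + 2 * x * ‖w'‖) (by fun_prop) ?_
    filter_upwards [hnear] with x ⟨hx0, hx1, hx⟩
    have h1 := (abs_le.1 (hlau x s hx0 hx1)).2
    have h2 := (abs_le.1 (hlau' x s hx0 hx1)).1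
    have h3 := (M.optValue_spec (γ := 1 - x) (by linarith) (by linarith)).1 π' s
    rw [← hx] at h3
    have h4 : (ρ' s - ρ s) / x ≤ (w - M.policyOp π w) s + 2 * x * ‖w‖
      - (w' - M.policyOp π' w') s + 2 * x * ‖w'‖ := by
      rw [sub_div]
      linarith
    rwa [div_le_iff₀' hx0] at h4
  rw [hbias, hgain]
  set g := w - M.policyOp π w with hg
  -- The expansion of the value of `π` is inserted in the discounted Bellman inequality, which is
  -- then multiplied by `x = 1 - γ`. Order `1 / x` gives `P ρ ≤ ρ`; where equality holds, the
  -- constant order gives the bias inequality.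
  have hmain : ∀ s a, ∀ᶠ x in 𝓝[>] (0 : ℝ), M.expNext s a ρ - ρ s ≤
      x * (g s + 2 * x * ‖w‖ - M.r s a + M.expNext s a ρ
        - (1 - x) * (M.expNext s a g - 2 * x * ‖w‖)) := fun s a => by
    filter_upwards [hnear] with x ⟨hx0, hx1, hx⟩
    have h1 := (abs_le.1 (hlau x s hx0 hx1)).2
    have h2 := (M.optValue_spec (γ := 1 - x) (by linarith) (by linarith)).2.2 s a
    rw [← hx] at h2
    have h3 : x⁻¹ • ρ + g - (fun _ => 2 * x * ‖w‖) ≤ M.value (1 - x) π := fun i => by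
      have := (abs_le.1 (hlau x i hx0 hx1)).1
      rw [div_eq_inv_mul] at this
      simp only [Pi.sub_apply, Pi.add_apply, Pi.smul_apply, smul_eq_mul] at this ⊢
      linarith
    have h4 := M.expNext_mono s a h3
    rw [expNext_sub, expNext_add, expNext_smul, expNext_const] at h4
    have h5 := mul_le_mul_of_nonneg_left h4 (by linarith : 0 ≤ 1 - x)
    have hxx : x * x⁻¹ = 1 := mul_inv_cancel₀ hx0.ne'
    have h6 : (M.expNext s a ρ - ρ s) / x ≤ g s + 2 * x * ‖w‖ - M.r s a + M.expNext s a ρ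
        - (1 - x) * (M.expNext s a g - 2 * x * ‖w‖) := by
      have h7 : (1 - x) * (x⁻¹ * M.expNext s a ρ)
          = x⁻¹ * M.expNext s a ρ - M.expNext s a ρ := by
        linear_combination (-M.expNext s a ρ) * hxx
      rw [div_eq_inv_mul] at h1 ⊢
      linarith
    rwa [div_le_iff₀' hx0] at h6
  have hexp : ∀ s a, M.expNext s a ρ ≤ ρ s := fun s a =>
    sub_nonpos.1 (nonpos_of_eventually_le_mul (by fun_prop) (hmain s a))
  have hnonneg : 0 ≤ ρ := fun s => by
    refine neg_nonpos.1 (nonpos_of_eventually_le_mul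
      (φ := fun x => g s + 2 * x * ‖w‖) (by fun_prop) ?_)
    filter_upwards [hnear] with x ⟨hx0, hx1, _⟩
    have h1 := (abs_le.1 (hlau x s hx0 hx1)).2
    have h2 : 0 ≤ M.value (1 - x) π := by
      refine M.le_value (by linarith) (by linarith) π ?_
      have := policyAvg_mono π (f := fun _ _ => 0) M.r_nonneg
      rw [policyAvg_state π fun _ => 0] at this
      rw [map_zero, smul_zero, add_zero]
      exact this
    have h3 : (-ρ s) / x ≤ g s + 2 * x * ‖w‖ := by
      have := h2 s
      simp only [Pi.zero_apply] at this
      rw [neg_div]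
      linarith
    rwa [div_le_iff₀' hx0] at h3
  refine ⟨hnonneg, hρ, hw, hexp, fun s a hsa => ?_⟩
  have hm := hmain s a
  rw [hsa, sub_self] at hm
  have := nonneg_of_eventually_nonneg_mul (by fun_prop) hm
  simp only [mul_zero, zero_mul, sub_zero, one_mul, add_zero] at this
  linarith

end MDP

theorem lemma6 {S A : Type*} [Fintype S] [Nonempty S] [Fintype A] [Nonempty A]
    [MeasurableSpace S] [DiscreteMeasurableSpace S]
    [MeasurableSpace A] [DiscreteMeasurableSpace A]
    (M : MDP S A) (γ : ℝ) (hγ0 : 0 < γ) (hγ1 : γ < 1)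
    (ρ h : S → ℝ) (hmod : M.ModifiedBellman ρ h) (hunmod : M.UnmodifiedBellman ρ h)
    (πs : RandPolicy S A) (hπs : M.IsBlackwellOptimal πs)
    (t : ℕ) (ht0 : 0 < t) (ht : (t : ℝ) ≤ 1 / (1 - γ)) :
    M.dropTime ≠ ∞ ∧
    ‖(1 / ((t : ℝ) * (1 - γ))) • (M.bellman 1)^[t] 0 - M.optValue γ‖ ≤
      2 * (min (spanSeminorm h)
            (spanSeminorm (M.bias πs) + M.dropTime.toReal
              + spanSeminorm (M.bias πs) * M.dropTime.toReal) / (t : ℝ)) * (1 / (1 - γ)) := by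
  obtain ⟨hr0, hfix, hpois, hexp, hunif⟩ := hπs.spec
  have htop := M.dropTime_ne_top hexp
  refine ⟨htop, ?_⟩
  set b := M.bias πs
  set D := M.dropTime.toReal
  rcases min_choice (spanSeminorm h) (spanSeminorm b + D + spanSeminorm b * D) with he | he <;>
    rw [he]
  · have hact := fun s => (hunmod.2 s).1
    choose d hd1 hd2 using hact
    refine M.norm_iterate_bellman_sub_optValue_le hγ0.le hγ1 (RandPolicy.ofDet d) (ρ := ρ) (g := h)
      (g' := h) ?_ ?_ (fun s a => (hmod.1 s).2 ⟨a, rfl⟩) (fun s a => (hmod.2 s).2 ⟨a, rfl⟩) le_rfl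
      (sub_le_spanSeminorm h) ht0 ht
    · ext s
      rw [MDP.policyOp_apply, MDP.policyAvg_ofDet, hd1]
    · ext s
      simp only [Pi.sub_apply, Pi.add_apply, MDP.policyOp_apply, MDP.policyAvg_ofDet]
      linarith [hd2 s]
  · obtain ⟨U, ⟨hU0, hU1⟩, hU⟩ := M.exists_dropTime_potential hexp
    have hb0 : 0 ≤ spanSeminorm b := spanSeminorm_nonneg b
    have hD0 : 0 ≤ D := ENNReal.toReal_nonneg
    -- The multiple of `U` pays for a dropping action, where `r ≤ 1`, the optimal gain is
    -- nonnegative and `P b` exceeds `b s` by at most the span. As `0 ≤ U ≤ D`, the span grows by at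
    -- most `(1 + spanSeminorm b) * D`.
    refine M.norm_iterate_bellman_sub_optValue_le hγ0.le hγ1 πs hfix hpois
      (g' := b + (1 + spanSeminorm b) • U) hexp ?_ ?_ ?_ ht0 ht
    · intro s a
      have h1 := mul_le_mul_of_nonneg_left (hU s a) (by linarith : 0 ≤ 1 + spanSeminorm b)
      rw [MDP.expNext_add, MDP.expNext_smul]
      simp only [Pi.add_apply, Pi.smul_apply, smul_eq_mul]
      rcases (hexp s a).lt_or_eq with hlt | heq
      · rw [MDP.dropCost, if_pos hlt] at h1
        have h2 : M.expNext s a b ≤ b s + spanSeminorm b := by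
          have h3 : b ≤ fun _ => b s + spanSeminorm b := fun s' => by
            linarith [sub_le_spanSeminorm b s' s]
          have h4 := M.expNext_mono s a h3
          rwa [MDP.expNext_const] at h4
        have h5 : 0 ≤ M.optGain s := hr0 s
        linarith [M.r_le_one s a]
      · rw [MDP.dropCost, if_neg heq.not_lt] at h1
        linarith [hunif s a heq]
    · linarith [mul_nonneg hb0 hD0]
    · intro s s'
      have h1 := mul_le_mul_of_nonneg_left (hU1 s) (by linarith : 0 ≤ 1 + spanSeminorm b)
      have h2 := mul_nonneg (by linarith : 0 ≤ 1 + spanSeminorm b) (hU0 s')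
      simp only [Pi.add_apply, Pi.smul_apply, smul_eq_mul]
      linarith [sub_le_spanSeminorm b s s']
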